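/- Let $\Bbbk$ be an algebraically closed field, let $C$ be a commutative noetherian domain which is a $\Bbbk$-algebra, and let $G$ be a polycyclic-by-finite group acting on $C$ by ring automorphisms, the image of $c\in C$ under $g\in G$ being denoted $c^g$. Let $B=C\# G$ be the skew group ring, that is, the free left $C$-module with basis $G$ and multiplication determined by $(rh)(sg)=(r\,s^h)(hg)$ for $r,s\in C$ and $g,h\in G$. Let $I$ be a maximal ideal of $C$, let $p\in\operatorname{Spec} C$ be the point with $V(I)=\{p\}$, and let $$R=\mathbb{I}_B(IB)=\{b\in B \mid b\,IB\subseteq IB\}$$ be the idealiser in $B$ of the right ideal $IB$. Let $G.p\subseteq \operatorname{Spec} C$ be the orbit of $p$ under the induced action of $G$. An infinite subset $S$ of $\operatorname{Spec} C$ is called critically dense if $S\cap Y$ is finite for every proper Zariski-closed subset $Y\subsetneq \operatorname{Spec} C$. **Theorem.** The ring $R$ is always right noetherian. Further, $R$ is left noetherian if and only if $G.p$ is either finite or critically dense. (Thus, if the orbit $G.p$ is infinite, $R$ is left noetherian if and only if $G.p$ is critically dense.) -/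

import Mathlib

/-- A group is polycyclic if it has a finite subnormal series
`1 = H 0 ⊴ H 1 ⊴ ⋯ ⊴ H n = G` all of whose factors are cyclic. -/
def IsPolycyclic (G : Type*) [Group G] : Prop :=
  ∃ (n : ℕ) (H : ℕ → Subgroup G), H 0 = ⊥ ∧ H n = ⊤ ∧
    ∀ i < n, H i ≤ H (i + 1) ∧
      ∃ _ : ((H i).subgroupOf (H (i + 1))).Normal,
        IsCyclic (H (i + 1) ⧸ (H i).subgroupOf (H (i + 1)))

/-- A group is polycyclic-by-finite if it has a normal polycyclic subgroup of finite index. -/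
def IsPolycyclicByFinite (G : Type*) [Group G] : Prop :=
  ∃ N : Subgroup G, N.Normal ∧ N.FiniteIndex ∧ IsPolycyclic N

/-- Right ideals of a ring `B` are the submodules of `B` over the opposite ring. -/
abbrev RightIdeal (B : Type*) [Ring B] : Type _ := Submodule Bᵐᵒᵖ B

/-- The idealiser `{b ∈ B | b J ⊆ J}` of a right ideal `J` of a ring `B`, as a subring of `B`. -/
def idealiser {B : Type*} [Ring B] (J : RightIdeal B) : Subring B where
  carrier := {b | ∀ x ∈ J, b * x ∈ J}
  mul_mem' := fun {a b} ha hb x hx => by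
    rw [mul_assoc]
    exact ha _ (hb x hx)
  one_mem' := fun x hx => by simpa using hx
  add_mem' := fun {a b} ha hb x hx => by
    rw [add_mul]
    exact J.add_mem (ha x hx) (hb x hx)
  zero_mem' := fun x _ => by simp
  neg_mem' := fun {a} ha x hx => by
    rw [neg_mul]
    exact J.neg_mem (ha x hx)

/-- The right ideal `I B` of the skew group ring `B = C # G` generated by (the image in `B` of)
an ideal `I` of `C`.  In `SkewMonoidAlgebra C G` the product is determined by
`(r h) (s g) = (r (h • s)) (h g)`, and `C` embeds by `c ↦ c 1`. -/
noncomputable def skewExtension {C : Type*} (G : Type*) [CommRing C] [Group G]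
    [MulSemiringAction G C] (I : Ideal C) : RightIdeal (SkewMonoidAlgebra C G) :=
  Submodule.span (SkewMonoidAlgebra C G)ᵐᵒᵖ
    ((fun c : C => (SkewMonoidAlgebra.single (1 : G) c : SkewMonoidAlgebra C G)) '' (I : Set C))

/-- The action of `G` on `Spec C` induced by an action of `G` on `C` by ring automorphisms:
the prime `P` is sent by `g` to its image `{g • c | c ∈ P}`, the preimage of `P` under `g⁻¹`. -/
noncomputable instance PrimeSpectrum.inducedMulAction {G C : Type*} [Group G] [CommRing C]
    [MulSemiringAction G C] : MulAction G (PrimeSpectrum C) where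
  smul g p := PrimeSpectrum.comap (MulSemiringAction.toRingHom G C g⁻¹) p
  one_smul p := by
    apply PrimeSpectrum.ext
    ext c
    change (1 : G)⁻¹ • c ∈ p.asIdeal ↔ c ∈ p.asIdeal
    simp
  mul_smul g h p := by
    apply PrimeSpectrum.ext
    ext c
    change (g * h)⁻¹ • c ∈ p.asIdeal ↔ h⁻¹ • g⁻¹ • c ∈ p.asIdeal
    rw [mul_inv_rev, mul_smul]

/-- An infinite subset `S` of a space `X` is critically dense if it meets every proper closed
subset of `X` in a finite set. -/
def IsCriticallyDense {X : Type*} [TopologicalSpace X] (S : Set X) : Prop :=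
  S.Infinite ∧ ∀ Y : Set X, IsClosed Y → Y ≠ Set.univ → (S ∩ Y).Finite

/-! The idealiser `R` consists of the sums of terms `c g` with `c ∈ I` or `g • p = p`; in particular
`IB ⊆ R`. Both noetherian statements rest on Hall's form of the Hilbert basis theorem,
`StableACC.of_isPolycyclicByFinite`, stated for abelian groups with operators so that it serves
twice.

Right side: Hall's theorem makes `B` right noetherian. For a right ideal `K` of `R`, the ideals `KB`
and `KIB` of `B` control `K`: `KIB ⊆ K`, and an element of `KB` enters `K` after multiplication by
any scalar vanishing at suitable finitely many orbit points other than `p`. Such a scalar can be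
chosen congruent to `1` modulo `I`.

Left side: `G` does not lie in `R`, so a left ideal `K` is recorded together with `BK` and all
translates `gK`, one for each orbit point `q = g • p`. On this sum `G` acts, and `I_q BK ⊆ gK ⊆ BK`,
where `I_q` is the ideal of `q`. Hall's theorem reduces the problem to families of ideals `M`, `L_q`
of `C` with `I_q M ⊆ L_q ⊆ M`, and `L_q ⊆ I_q` for `q ≠ p`. Wherever `M ⊄ I_q` these force `L_q =
I_q M`, so the chain condition holds if each nonzero `M` vanishes at finitely many orbit points
(`OrbitSum.stableACC_scalars`).

Conversely, for `f ≠ 0` a finite generating set of the left ideal `IB ∩ Bf` of `R` bounds the zeros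
of `f` on the orbit. -/

/-- A group acts on `F` through `u`; `A` is a set of operators, and `N` a set of group elements. -/
structure IsStableUnder {E F G : Type*} [Ring E] [AddCommGroup F] [Module E F] [Group G]
    (u : G →* E) (A : Set E) (N : Subgroup G) (S : AddSubgroup F) : Prop where
  op : ∀ a ∈ A, ∀ x ∈ S, a • x ∈ S
  grp : ∀ n ∈ N, ∀ x ∈ S, u n • x ∈ S

/-- Ascending chain condition on the stable subgroups contained in `W`. -/
def StableACC {E F G : Type*} [Ring E] [AddCommGroup F] [Module E F] [Group G]
    (u : G →* E) (A : Set E) (N : Subgroup G) (W : AddSubgroup F) : Prop :=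
  ∀ S : ℕ → AddSubgroup F, Monotone S → (∀ i, S i ≤ W) → (∀ i, IsStableUnder u A N (S i)) →
    ∃ n, ∀ m, n ≤ m → S m ≤ S n

/-! ### Hall's theorem for groups with operators -/

section Stable

variable {E F G : Type*} [Ring E] [AddCommGroup F] [Module E F] [Group G]
  {u : G →* E} {A : Set E}

/-- The subgroup of `F` generated by the translates of `V` under `N`. -/
def translateSpan (u : G →* E) (N : Subgroup G) (V : AddSubgroup F) : AddSubgroup F :=
  AddSubgroup.closure {x | ∃ n ∈ N, ∃ v ∈ V, x = u n • v}

/-- The translate of a subgroup of `F` by a group element. -/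
def translateBy (u : G →* E) (g : G) (S : AddSubgroup F) : AddSubgroup F :=
  S.comap (DistribSMul.toAddMonoidHom F (u g⁻¹))

theorem mem_translateBy {g : G} {S : AddSubgroup F} {x : F} :
    x ∈ translateBy u g S ↔ u g⁻¹ • x ∈ S := Iff.rfl

theorem inv_smul_smul_hom (u : G →* E) (g : G) (x : F) : u g⁻¹ • u g • x = x := by
  rw [← mul_smul, ← map_mul, inv_mul_cancel, map_one, one_smul]

theorem smul_inv_smul_hom (u : G →* E) (g : G) (x : F) : u g • u g⁻¹ • x = x := by
  rw [← mul_smul, ← map_mul, mul_inv_cancel, map_one, one_smul]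

theorem smul_mem_translateBy {g : G} {S : AddSubgroup F} {x : F} (hx : x ∈ S) :
    u g • x ∈ translateBy u g S := by
  rw [mem_translateBy, inv_smul_smul_hom]; exact hx

namespace IsStableUnder

variable {N : Subgroup G} {S T : AddSubgroup F}

theorem sup (hS : IsStableUnder u A N S) (hT : IsStableUnder u A N T) :
    IsStableUnder u A N (S ⊔ T) := by
  constructor
  · intro a ha x hx
    obtain ⟨y, hy, z, hz, rfl⟩ := AddSubgroup.mem_sup.1 hx
    rw [smul_add]
    exact AddSubgroup.mem_sup.2 ⟨_, hS.op a ha y hy, _, hT.op a ha z hz, rfl⟩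
  · intro a ha x hx
    obtain ⟨y, hy, z, hz, rfl⟩ := AddSubgroup.mem_sup.1 hx
    rw [smul_add]
    exact AddSubgroup.mem_sup.2 ⟨_, hS.grp a ha y hy, _, hT.grp a ha z hz, rfl⟩

theorem inf (hS : IsStableUnder u A N S) (hT : IsStableUnder u A N T) :
    IsStableUnder u A N (S ⊓ T) :=
  ⟨fun a ha x hx => ⟨hS.op a ha x hx.1, hT.op a ha x hx.2⟩,
    fun a ha x hx => ⟨hS.grp a ha x hx.1, hT.grp a ha x hx.2⟩⟩

theorem bot : IsStableUnder u A N (⊥ : AddSubgroup F) :=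
  ⟨fun a _ x hx => by simp_all, fun a _ x hx => by simp_all⟩

theorem mono {N' : Subgroup G} (h : N ≤ N') (hS : IsStableUnder u A N' S) :
    IsStableUnder u A N S :=
  ⟨hS.op, fun n hn => hS.grp n (h hn)⟩

theorem translate (hA : ∀ g, ∀ a ∈ A, u g * a * u g⁻¹ ∈ A) {t : G}
    (ht : ∀ n ∈ N, t⁻¹ * n * t ∈ N) (hS : IsStableUnder u A N S) :
    IsStableUnder u A N (translateBy u t S) := by
  constructor
  · intro a ha x hx
    rw [mem_translateBy] at *
    have := hS.op _ (hA t⁻¹ a ha) _ hx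
    rwa [mul_smul, mul_smul, inv_inv, smul_inv_smul_hom] at this
  · intro n hn x hx
    rw [mem_translateBy] at *
    have := hS.grp _ (ht n hn) _ hx
    rwa [map_mul, map_mul, mul_smul, mul_smul, smul_inv_smul_hom] at this

theorem translateSpan (hA : ∀ g, ∀ a ∈ A, u g * a * u g⁻¹ ∈ A) {V : AddSubgroup F}
    (hV : ∀ a ∈ A, ∀ v ∈ V, a • v ∈ V) : IsStableUnder u A N (translateSpan u N V) := by
  constructor
  · intro a ha x hx
    induction hx using AddSubgroup.closure_induction with
    | mem x hx =>
      obtain ⟨n, hn, v, hv, rfl⟩ := hx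
      refine AddSubgroup.subset_closure ⟨n, hn, _, hV _ (hA n⁻¹ a ha) v hv, ?_⟩
      rw [mul_smul, mul_smul, smul_inv_smul_hom, inv_inv]
    | zero => simp
    | add x y _ _ hx hy => rw [smul_add]; exact add_mem hx hy
    | neg x _ hx => rw [smul_neg]; exact neg_mem hx
  · intro a ha x hx
    induction hx using AddSubgroup.closure_induction with
    | mem x hx =>
      obtain ⟨n, hn, v, hv, rfl⟩ := hx
      exact AddSubgroup.subset_closure ⟨a * n, mul_mem ha hn, v, hv, by rw [map_mul, mul_smul]⟩
    | zero => simp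
    | add x y _ _ hx hy => rw [smul_add]; exact add_mem hx hy
    | neg x _ hx => rw [smul_neg]; exact neg_mem hx

end IsStableUnder

/-- The diagonal stabilises at some `n₀`, which settles every column `k ≥ n₀`; the finitely many
columns left stabilise one by one. -/
theorem StableACC.exists_uniform {N : Subgroup G} {W : AddSubgroup F} (h : StableACC u A N W)
    (S : ℕ → ℕ → AddSubgroup F) (h₁ : ∀ k, Monotone (S · k)) (h₂ : ∀ i, Monotone (S i))
    (hW : ∀ i k, S i k ≤ W) (hS : ∀ i k, IsStableUnder u A N (S i k)) :
    ∃ n, ∀ m, n ≤ m → ∀ k, S m k ≤ S n k := by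
  obtain ⟨n₀, hn₀⟩ := h (fun i => S i i) (fun i j hij => (h₁ i hij).trans (h₂ j hij))
    (fun i => hW i i) (fun i => hS i i)
  choose f hf using fun k => h (S · k) (h₁ k) (hW · k) (hS · k)
  refine ⟨n₀ + ∑ k ∈ Finset.range n₀, f k, fun m hm k => ?_⟩
  rcases lt_or_ge k n₀ with hk | hk
  · have hfk : f k ≤ n₀ + ∑ k ∈ Finset.range n₀, f k :=
      (Finset.single_le_sum (f := f) (fun _ _ => Nat.zero_le _) (Finset.mem_range.2 hk)).trans
        (Nat.le_add_left _ _)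
    exact (hf k m (hfk.trans hm)).trans (h₁ k hfk)
  · have h3 : S m k ≤ S (m + k) (m + k) :=
      (h₁ k (Nat.le_add_right m k)).trans (h₂ _ (Nat.le_add_left k m))
    exact (h3.trans (hn₀ _ (by omega))).trans ((h₂ n₀ hk).trans (h₁ k (Nat.le_add_right _ _)))

theorem StableACC.sup {N : Subgroup G} {X Y : AddSubgroup F} (hX : StableACC u A N X)
    (hY : StableACC u A N Y) (sX : IsStableUnder u A N X) (sY : IsStableUnder u A N Y) :
    StableACC u A N (X ⊔ Y) := by
  intro S hm hS hst
  obtain ⟨n₁, h₁⟩ := hX (fun i => X ⊓ (S i ⊔ Y))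
    (fun i j hij => inf_le_inf_left _ (sup_le_sup_right (hm hij) _)) (fun i => inf_le_left)
    (fun i => sX.inf ((hst i).sup sY))
  obtain ⟨n₂, h₂⟩ := hY (fun i => S i ⊓ Y) (fun i j hij => inf_le_inf_right _ (hm hij))
    (fun i => inf_le_right) (fun i => (hst i).inf sY)
  refine ⟨n₁ + n₂, fun m hmn x hx => ?_⟩
  obtain ⟨a, ha, b, hb, rfl⟩ := AddSubgroup.mem_sup.1 (hS m hx)
  have ha' : a ∈ X ⊓ (S m ⊔ Y) :=
    ⟨ha, AddSubgroup.mem_sup.2 ⟨a + b, hx, -b, neg_mem hb, by abel⟩⟩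
  obtain ⟨s, hs, y, hy, hsy⟩ := AddSubgroup.mem_sup.1 (h₁ m (by omega) ha').2
  have hs' := hm (show n₁ ≤ n₁ + n₂ by omega) hs
  have h3 : y + b ∈ S m ⊓ Y :=
    ⟨by
      have := sub_mem hx (hm hmn hs')
      rwa [← hsy, show s + y + b - s = y + b by abel] at this, add_mem hy hb⟩
  have h4 := hm (show n₂ ≤ n₁ + n₂ by omega) (h₂ m (by omega) h3).1
  rw [← hsy, add_assoc]
  exact add_mem hs' h4

theorem StableACC.translate (hA : ∀ g, ∀ a ∈ A, u g * a * u g⁻¹ ∈ A) {N : Subgroup G}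
    {X : AddSubgroup F} (hX : StableACC u A N X) {t : G} (ht : ∀ n ∈ N, t * n * t⁻¹ ∈ N) :
    StableACC u A N (translateBy u t X) := by
  intro S hm hS hst
  obtain ⟨n, hn⟩ := hX (fun i => translateBy u t⁻¹ (S i))
    (fun i j hij => AddSubgroup.comap_mono (hm hij))
    (fun i x hx => by
      rw [mem_translateBy, inv_inv] at hx
      have := hS i hx
      rwa [mem_translateBy, inv_smul_smul_hom] at this)
    (fun i => (hst i).translate hA (by simpa using ht))
  refine ⟨n, fun m hnm x hx => ?_⟩
  have := @hn m hnm (u t⁻¹ • x) (smul_mem_translateBy hx)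
  rwa [mem_translateBy, inv_inv, smul_inv_smul_hom] at this

theorem StableACC.of_le {N N' : Subgroup G} {X Y : AddSubgroup F} (hX : StableACC u A N X)
    (hN : N ≤ N') (h : Y ≤ X) : StableACC u A N' Y :=
  fun S hm hS hst => hX S hm (fun i => (hS i).trans h) (fun i => (hst i).mono hN)

/-- The translates under `G` are a finite sum, over coset representatives, of translates of the span
under `N`, each inheriting the chain condition. -/
theorem StableACC.of_finiteIndex (hA : ∀ g, ∀ a ∈ A, u g * a * u g⁻¹ ∈ A) (N : Subgroup G)
    [N.Normal] [N.FiniteIndex] {V : AddSubgroup F} (hV : ∀ a ∈ A, ∀ v ∈ V, a • v ∈ V)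
    (h : StableACC u A N (translateSpan u N V)) : StableACC u A ⊤ (translateSpan u ⊤ V) := by
  have hst : IsStableUnder u A N (translateSpan u N V) := .translateSpan hA hV
  have hconj : ∀ t : G, ∀ n ∈ N, t * n * t⁻¹ ∈ N := fun t n hn => ‹N.Normal›.conj_mem n hn t
  have key : ∀ s : Finset (G ⧸ N),
      StableACC u A N (s.sup fun q => translateBy u q.out (translateSpan u N V)) ∧
      IsStableUnder u A N (s.sup fun q => translateBy u q.out (translateSpan u N V)) := by
    classical
    intro s
    induction s using Finset.induction_on with
    | empty =>
      refine ⟨fun S hm hS _ => ⟨0, fun m _ => (hS m).trans ?_⟩, .bot⟩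
      simp
    | insert q s _ ih =>
      have hq : IsStableUnder u A N (translateBy u q.out (translateSpan u N V)) :=
        hst.translate hA (fun n hn => by simpa using hconj q.out⁻¹ n hn)
      rw [Finset.sup_insert]
      exact ⟨(h.translate hA (hconj _)).sup ih.1 hq ih.2, hq.sup ih.2⟩
  have := Fintype.ofFinite (G ⧸ N)
  refine (key Finset.univ).1.of_le le_top ?_
  refine (AddSubgroup.closure_le _).2 ?_
  rintro _ ⟨g, -, v, hv, rfl⟩
  refine Finset.le_sup (f := fun q : G ⧸ N => translateBy u q.out (translateSpan u N V))
    (Finset.mem_univ (g : G ⧸ N)) ?_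
  rw [mem_translateBy, ← mul_smul, ← map_mul]
  exact AddSubgroup.subset_closure ⟨_, QuotientGroup.eq.1 (QuotientGroup.out_eq' _), v, hv, rfl⟩

/-- The translates of `W` by `t⁻¹, …, t⁻ᵏ` generate this subgroup. -/
def lowerTranslates (u : G →* E) (t : G) (W : AddSubgroup F) : ℕ → AddSubgroup F
  | 0 => ⊥
  | k + 1 => translateBy u t⁻¹ (W ⊔ lowerTranslates u t W k)

theorem lowerTranslates_mono (u : G →* E) (t : G) (W : AddSubgroup F) :
    Monotone (lowerTranslates u t W) := by
  refine monotone_nat_of_le_succ fun k => ?_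
  induction k with
  | zero => exact bot_le
  | succ k ih => exact AddSubgroup.comap_mono (sup_le_sup_left ih _)

theorem IsStableUnder.lowerTranslates (hA : ∀ g, ∀ a ∈ A, u g * a * u g⁻¹ ∈ A)
    {N : Subgroup G} {W : AddSubgroup F} (hW : IsStableUnder u A N W) {t : G}
    (ht : ∀ n ∈ N, t * n * t⁻¹ ∈ N) (k : ℕ) :
    IsStableUnder u A N (lowerTranslates u t W k) := by
  induction k with
  | zero => exact .bot
  | succ k ih => exact (hW.sup ih).translate hA (by simpa using ht)

/-- The division step of Hilbert's argument: elements are Laurent polynomials in `t` of degree at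
most `0`, and `W ⊓ (S ⊔ lowerTranslates u t W k)` collects the leading coefficients of `S`.
Subtracting an element of `S` removes the leading term, and multiplication by `t` then lowers `k`.
-/
theorem le_of_leading_le {t : G} {W S S' : AddSubgroup F} (hSS : S ≤ S')
    (hS : ∀ x ∈ S, u t⁻¹ • x ∈ S) (hS' : ∀ x ∈ S', u t • x ∈ S')
    (h : ∀ k, W ⊓ (S' ⊔ lowerTranslates u t W k) ≤ W ⊓ (S ⊔ lowerTranslates u t W k)) (k : ℕ) :
    S' ⊓ (W ⊔ lowerTranslates u t W k) ≤ S := by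
  induction k with
  | zero =>
    rintro x ⟨hx, hxW⟩
    have := (@h 0 x ⟨by simpa [lowerTranslates] using hxW, AddSubgroup.mem_sup_left hx⟩).2
    simpa [lowerTranslates] using this
  | succ k ih =>
    rintro x ⟨hx, hxW⟩
    obtain ⟨a, ha, b, hb, rfl⟩ := AddSubgroup.mem_sup.1 hxW
    have ha' : a ∈ W ⊓ (S' ⊔ lowerTranslates u t W (k + 1)) :=
      ⟨ha, AddSubgroup.mem_sup.2 ⟨a + b, hx, -b, neg_mem hb, by abel⟩⟩
    obtain ⟨s, hs, y, hy, hsy⟩ := AddSubgroup.mem_sup.1 (h _ ha').2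
    have hyb : y + b ∈ S' := by
      have := S'.sub_mem hx (hSS hs)
      rwa [← hsy, show s + y + b - s = y + b by abel] at this
    have h5 : u t • (y + b) ∈ S := by
      refine ih ⟨hS' _ hyb, ?_⟩
      have : y + b ∈ lowerTranslates u t W (k + 1) := add_mem hy hb
      rwa [lowerTranslates, mem_translateBy, inv_inv] at this
    have h6 := hS _ h5
    rw [inv_smul_smul_hom] at h6
    rw [← hsy, add_assoc]
    exact add_mem hs h6

theorem exists_pow_smul_mem {t : G} {N N' : Subgroup G} {V : AddSubgroup F}
    (ht : ∀ x ∈ N', ∃ j : ℤ, ∃ n ∈ N, x = t ^ j * n) {x : F} (hx : x ∈ translateSpan u N' V) :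
    ∃ m k : ℕ, u (t⁻¹ ^ m) • x ∈
      translateSpan u N V ⊔ lowerTranslates u t (translateSpan u N V) k := by
  set W := translateSpan u N V
  have step : ∀ (k : ℕ) (x : F), x ∈ W ⊔ lowerTranslates u t W k → ∀ j : ℕ,
      u (t⁻¹ ^ j) • x ∈ W ⊔ lowerTranslates u t W (k + j) := by
    intro k x hx j
    induction j with
    | zero => simpa using hx
    | succ j ih =>
      rw [pow_succ', map_mul, mul_smul]
      exact AddSubgroup.mem_sup_right (smul_mem_translateBy ih)
  induction hx using AddSubgroup.closure_induction with
  | mem x hx =>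
    obtain ⟨g, hg, v, hv, rfl⟩ := hx
    obtain ⟨j, n, hn, rfl⟩ := ht g hg
    -- Multiplication by `t` to the power `-|j|` makes the exponent nonpositive for either sign of
    -- `j`.
    obtain ⟨i, hi⟩ : ∃ i : ℕ, -(j.natAbs : ℤ) + j = -(i : ℤ) := ⟨(j.natAbs - j).toNat, by omega⟩
    refine ⟨j.natAbs, 0 + i, ?_⟩
    have := step 0 (u n • v)
      (AddSubgroup.mem_sup_left (AddSubgroup.subset_closure ⟨n, hn, v, hv, rfl⟩)) i
    have e : t⁻¹ ^ j.natAbs * (t ^ j * n) = t⁻¹ ^ i * n := by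
      rw [← mul_assoc]
      congr 1
      rw [inv_pow, inv_pow, ← zpow_natCast, ← zpow_natCast, ← zpow_neg, ← zpow_neg, ← zpow_add, hi]
    rwa [← mul_smul, ← map_mul, ← e, map_mul, mul_smul] at this
  | zero => exact ⟨0, 0, by simp⟩
  | add x y _ _ hx hy =>
    obtain ⟨m, k, hx⟩ := hx
    obtain ⟨m', k', hy⟩ := hy
    refine ⟨m + m', (k + m') + (k' + m), ?_⟩
    rw [smul_add]
    refine add_mem ?_ ?_
    · have := step k _ hx m'
      rw [← mul_smul, ← map_mul, ← pow_add, add_comm m' m] at this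
      exact sup_le_sup_left (lowerTranslates_mono u t W (by omega)) _ this
    · have := step k' _ hy m
      rw [← mul_smul, ← map_mul, ← pow_add] at this
      exact sup_le_sup_left (lowerTranslates_mono u t W (by omega)) _ this
  | neg x _ hx =>
    obtain ⟨m, k, hx⟩ := hx
    exact ⟨m, k, by rw [smul_neg]; exact neg_mem hx⟩

/-- The Hilbert basis theorem for a cyclic extension of groups. -/
theorem StableACC.of_cyclic (hA : ∀ g, ∀ a ∈ A, u g * a * u g⁻¹ ∈ A) {N N' : Subgroup G}
    (hNN : N ≤ N') {t : G} (htN : t ∈ N') (hconj : ∀ n ∈ N, t * n * t⁻¹ ∈ N)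
    (ht : ∀ x ∈ N', ∃ j : ℤ, ∃ n ∈ N, x = t ^ j * n) {V : AddSubgroup F}
    (hV : ∀ a ∈ A, ∀ v ∈ V, a • v ∈ V)
    (h : StableACC u A N (translateSpan u N V)) : StableACC u A N' (translateSpan u N' V) := by
  intro S hm hS hst
  set W := translateSpan u N V
  have sW : IsStableUnder u A N W := .translateSpan hA hV
  -- The leading coefficients must stabilise simultaneously for all lengths `k`.
  obtain ⟨n, hn⟩ := h.exists_uniform (fun i k => W ⊓ (S i ⊔ lowerTranslates u t W k))
    (fun k i j hij => inf_le_inf_left _ (sup_le_sup_right (hm hij) _))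
    (fun i k l hkl => inf_le_inf_left _ (sup_le_sup_left (lowerTranslates_mono u t W hkl) _))
    (fun i k => inf_le_left)
    (fun i k => sW.inf (((hst i).mono hNN).sup (sW.lowerTranslates hA hconj k)))
  refine ⟨n, fun m hnm x hx => ?_⟩
  have hle := le_of_leading_le (hm hnm) ((hst n).grp _ (inv_mem htN)) ((hst m).grp _ htN)
    (hn m hnm)
  obtain ⟨i, k, hik⟩ := exists_pow_smul_mem ht (hS m hx)
  have h1 := hle k ⟨(hst m).grp _ (pow_mem (inv_mem htN) i) _ hx, hik⟩
  have h2 := (hst n).grp _ (inv_mem (pow_mem (inv_mem htN) i)) _ h1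
  rwa [inv_smul_smul_hom] at h2

theorem StableACC.of_isPolycyclic (hG : IsPolycyclic G)
    (hA : ∀ g, ∀ a ∈ A, u g * a * u g⁻¹ ∈ A) {V : AddSubgroup F}
    (hV : ∀ a ∈ A, ∀ v ∈ V, a • v ∈ V) (h : StableACC u A ⊥ V) :
    StableACC u A ⊤ (translateSpan u ⊤ V) := by
  obtain ⟨n, H, h0, hn, hH⟩ := hG
  rw [← hn]
  have key : ∀ i ≤ n, StableACC u A (H i) (translateSpan u (H i) V) := by
    intro i hi
    induction i with
    | zero =>
      rw [h0]
      refine h.of_le le_rfl ((AddSubgroup.closure_le _).2 ?_)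
      rintro _ ⟨g, hg, v, hv, rfl⟩
      rw [Subgroup.mem_bot.1 hg, map_one, one_smul]
      exact hv
    | succ i ih =>
      obtain ⟨hle, hnorm, hcyc⟩ := hH i hi
      obtain ⟨q, hq⟩ := hcyc.exists_generator
      obtain ⟨t, rfl⟩ := QuotientGroup.mk_surjective q
      refine (ih (by omega)).of_cyclic hA hle t.2 (fun x hx => ?_) (fun x hx => ?_) hV
      · have := hnorm.conj_mem ⟨x, hle hx⟩ (Subgroup.mem_subgroupOf.2 hx) t
        simpa [Subgroup.mem_subgroupOf] using this
      · obtain ⟨j, hj⟩ := Subgroup.mem_zpowers_iff.1 (hq (QuotientGroup.mk ⟨x, hx⟩))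
        rw [← QuotientGroup.mk_zpow, QuotientGroup.eq, Subgroup.mem_subgroupOf] at hj
        exact ⟨j, _, hj, by simp⟩
  exact key n le_rfl

/-- Hall's theorem: the ascending chain condition passes from `V` to the subgroup generated by the
translates of `V` under a polycyclic-by-finite group of operators. -/
theorem StableACC.of_isPolycyclicByFinite (hG : IsPolycyclicByFinite G)
    (hA : ∀ g, ∀ a ∈ A, u g * a * u g⁻¹ ∈ A) {V : AddSubgroup F}
    (hV : ∀ a ∈ A, ∀ v ∈ V, a • v ∈ V) (h : StableACC u A ⊥ V) :
    StableACC u A ⊤ (translateSpan u ⊤ V) := by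
  obtain ⟨N, hN, hfin, hpoly⟩ := hG
  refine StableACC.of_finiteIndex hA N hV ?_
  have := StableACC.of_isPolycyclic (u := u.comp N.subtype) hpoly (fun g a ha => hA g a ha) hV
    (fun S hm hS hst => h S hm hS fun i => ⟨(hst i).op, fun n hn x hx => by
      rw [Subgroup.mem_bot.1 hn, map_one, one_smul]; exact hx⟩)
  intro S hm hS hst
  refine this S hm (fun i => (hS i).trans ((AddSubgroup.closure_le _).2 ?_)) fun i =>
    ⟨(hst i).op, fun n _ x hx => (hst i).grp n n.2 x hx⟩
  rintro _ ⟨n, hn, v, hv, rfl⟩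
  exact AddSubgroup.subset_closure ⟨⟨n, hn⟩, trivial, v, hv, rfl⟩

end Stable

/-! ### Coefficients of elements of `IB` and of the idealiser -/

namespace SkewMonoidAlgebra

theorem mem_of_single_mem {C G : Type*} [CommRing C] {S : AddSubgroup (SkewMonoidAlgebra C G)} {b : SkewMonoidAlgebra C G}
    (h : ∀ g, single g (b.coeff g) ∈ S) : b ∈ S := by
  rw [← sum_single b]
  exact sum_mem fun g _ => h g

section Basic

variable {C G : Type*} [CommRing C] [Group G] [MulSemiringAction G C]

theorem mem_skewExtension {I : Ideal C} {b : SkewMonoidAlgebra C G} :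
    b ∈ skewExtension G I ↔ ∀ g, b.coeff g ∈ I := by
  constructor
  · intro hb
    suffices ∀ b' : SkewMonoidAlgebra C G, ∀ g, (b * b').coeff g ∈ I by simpa using this 1
    induction hb using Submodule.span_induction with
    | mem x hx =>
      obtain ⟨c, hc, rfl⟩ := hx
      intro b' g
      rw [coeff_single_mul]
      exact I.mul_mem_right _ hc
    | zero => simp
    | add x y _ _ hx hy =>
      intro b' g
      rw [add_mul, coeff_add]
      exact add_mem (hx b' g) (hy b' g)
    | smul r x _ hx =>
      intro b' g
      rw [← MulOpposite.op_unop r, MulOpposite.smul_eq_mul_unop, mul_assoc]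
      exact hx _ g
  · intro h
    refine mem_of_single_mem (S := (skewExtension G I).toAddSubgroup) fun g => ?_
    have h1 : (single 1 (b.coeff g) : SkewMonoidAlgebra C G) ∈ skewExtension G I :=
      Submodule.subset_span ⟨_, h g, rfl⟩
    have := (skewExtension G I).smul_mem (MulOpposite.op (single g 1)) h1
    rw [MulOpposite.smul_eq_mul_unop, MulOpposite.unop_op, single_mul_single] at this
    simpa using this

theorem mem_inducedMulAction_smul {g : G} {p : PrimeSpectrum C} {c : C} :
    c ∈ (g • p).asIdeal ↔ g⁻¹ • c ∈ p.asIdeal := Iff.rfl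

theorem smul_mem_of_smul_eq {g : G} {p : PrimeSpectrum C} (h : g • p = p) {c : C}
    (hc : c ∈ p.asIdeal) : g • c ∈ p.asIdeal := by
  rw [← h, mem_inducedMulAction_smul, inv_smul_smul]
  exact hc

theorem smul_eq_of_forall_mem {g : G} {p : PrimeSpectrum C} (hp : p.asIdeal.IsMaximal)
    (h : ∀ c ∈ p.asIdeal, g • c ∈ p.asIdeal) : g • p = p := by
  rw [eq_comm, ← inv_smul_eq_iff, eq_comm]
  exact PrimeSpectrum.ext (hp.eq_of_le (g⁻¹ • p).2.ne_top fun c hc => by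
    rw [mem_inducedMulAction_smul, inv_inv]; exact h c hc)

/-- The coefficient of `b c` at `g` is `b_g (g • c)`. If `b_g ∉ p`, primality puts `g • c` in `p`
for every `c ∈ p`, and maximality gives `g • p = p`. -/
theorem mem_idealiser_skewExtension {p : PrimeSpectrum C} (hp : p.asIdeal.IsMaximal)
    {b : SkewMonoidAlgebra C G} :
    b ∈ idealiser (skewExtension G p.asIdeal) ↔
      ∀ g : G, b.coeff g ∈ p.asIdeal ∨ g • p = p := by
  constructor
  · intro hb g
    by_contra! hg
    refine hg.2 (smul_eq_of_forall_mem hp fun c hc => ?_)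
    have h1 := mem_skewExtension.1
      (hb (single 1 c) (Submodule.subset_span ⟨c, hc, rfl⟩)) g
    rw [coeff_mul_single_one] at h1
    exact (p.2.mem_or_mem h1).resolve_left hg.1
  · intro hb x hx
    rw [← sum_single b, sum_mul]
    refine sum_mem fun g _ => ?_
    rw [mem_skewExtension] at *
    intro k
    rw [coeff_single_mul]
    rcases hb g with h | h
    · exact p.asIdeal.mul_mem_right _ h
    · exact p.asIdeal.mul_mem_left _ (smul_mem_of_smul_eq h (hx _))

theorem single_mem_idealiser {p : PrimeSpectrum C} (hp : p.asIdeal.IsMaximal) {g : G} {c : C}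
    (h : c ∈ p.asIdeal ∨ g • p = p) : single g c ∈ idealiser (skewExtension G p.asIdeal) := by
  classical
  rw [mem_idealiser_skewExtension hp]
  intro k
  rw [coeff_single_apply]
  split_ifs with hk
  · exact hk ▸ h
  · exact .inl (zero_mem _)

theorem mul_mem_idealiser {p : PrimeSpectrum C} (hp : p.asIdeal.IsMaximal) {c : C}
    (hc : c ∈ p.asIdeal) (b : SkewMonoidAlgebra C G) :
    single 1 c * b ∈ idealiser (skewExtension G p.asIdeal) := by
  rw [mem_idealiser_skewExtension hp]
  intro g
  rw [coeff_single_mul]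
  exact .inl (p.asIdeal.mul_mem_right _ hc)

/-- Scalars that are `1` modulo `p` and vanish at finitely many other points of the orbit. -/
theorem exists_one_sub_mem {p : PrimeSpectrum C} (hp : p.asIdeal.IsMaximal) (T : Finset G)
    (hT : ∀ g ∈ T, g • p ≠ p) :
    ∃ c : C, 1 - c ∈ p.asIdeal ∧ ∀ g ∈ T, g • c ∈ p.asIdeal := by
  classical
  induction T using Finset.induction_on with
  | empty => exact ⟨1, by simp, by simp⟩
  | insert g T _ ih =>
    obtain ⟨c, hc, hcT⟩ := ih fun h hh => hT h (Finset.mem_insert_of_mem hh)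
    obtain ⟨a, hag, ha⟩ : ∃ a, g • a ∈ p.asIdeal ∧ a ∉ p.asIdeal := by
      by_contra! h
      refine hT g (Finset.mem_insert_self _ _) (inv_smul_eq_iff.1 (smul_eq_of_forall_mem hp
        fun c hc => h _ ?_)).symm
      rwa [smul_inv_smul]
    obtain ⟨b, hb⟩ := hp.exists_inv ha
    obtain ⟨i, hi, hbi⟩ := hb
    refine ⟨b * a * c, ?_, fun h hh => ?_⟩
    · have : 1 - b * a * c = (1 - c) + i * c := by linear_combination -c * hbi
      rw [this]
      exact add_mem hc (p.asIdeal.mul_mem_right _ hi)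
    · rw [MulSemiringAction.smul_mul, MulSemiringAction.smul_mul]
      rcases Finset.mem_insert.1 hh with rfl | hh
      · exact p.asIdeal.mul_mem_right _ (p.asIdeal.mul_mem_left _ hag)
      · exact p.asIdeal.mul_mem_left _ (hcT h hh)

end Basic

/-! ### The idealiser is right noetherian -/

section RightNoetherian

variable {C G : Type*} [CommRing C] [IsNoetherianRing C] [Group G] [MulSemiringAction G C]

local notation "B" => SkewMonoidAlgebra C G

/-- The skew group ring of a polycyclic-by-finite group over a noetherian ring is right
noetherian. -/
theorem isNoetherian_op (hG : IsPolycyclicByFinite G) :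
    IsNoetherian (SkewMonoidAlgebra C G)ᵐᵒᵖ (SkewMonoidAlgebra C G) := by
  -- Right multiplication by `g⁻¹`; the inverse makes this a homomorphism into the opposite ring.
  let u : G →* Bᵐᵒᵖ :=
    { toFun := fun g => MulOpposite.op (single g⁻¹ 1)
      map_one' := by simp
      map_mul' := fun g h => by simp [← MulOpposite.op_mul, single_mul_single] }
  let A : Set Bᵐᵒᵖ := Set.range fun c : C => MulOpposite.op (single 1 c)
  let V : AddSubgroup B := (singleAddHom (1 : G) : C →+ B).range
  have hACC : StableACC u A ⊤ (translateSpan u ⊤ V) := by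
    refine StableACC.of_isPolycyclicByFinite hG ?_ ?_ ?_
    · rintro g _ ⟨c, rfl⟩
      refine ⟨g • c, ?_⟩
      simp [u, ← MulOpposite.op_mul, single_mul_single]
    · rintro _ ⟨c, rfl⟩ _ ⟨v, rfl⟩
      refine ⟨v * c, ?_⟩
      simp [single_mul_single]
    · intro S hm hS hst
      let K : ℕ →o Ideal C :=
        { toFun := fun i =>
            { carrier := {c | (single 1 c : B) ∈ S i}
              zero_mem' := by simp
              add_mem' := fun {a b} ha hb => by
                simpa using add_mem ha hb
              smul_mem' := fun c x hx => by
                have := (hst i).op _ ⟨c, rfl⟩ _ hx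
                simpa [single_mul_single, mul_comm x c] using this }
          monotone' := fun i j hij c hc => hm hij hc }
      obtain ⟨n, hn⟩ := monotone_stabilizes_iff_noetherian.2 ‹IsNoetherianRing C› K
      refine ⟨n, fun m hnm x hx => ?_⟩
      obtain ⟨c, rfl⟩ := hS m hx
      exact (hn m hnm).ge (show c ∈ K m from hx)
  rw [← monotone_stabilizes_iff_noetherian]
  intro f
  obtain ⟨n, hn⟩ := hACC (fun i => (f i).toAddSubgroup) (fun i j hij => f.monotone hij)
    (fun i x _ => mem_of_single_mem fun g => AddSubgroup.subset_closure
      ⟨g⁻¹, trivial, _, ⟨x.coeff g, rfl⟩, by simp [u, single_mul_single]⟩)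
    (fun i => ⟨fun a _ x hx => (f i).smul_mem a hx, fun a _ x hx => (f i).smul_mem (u a) hx⟩)
  exact ⟨n, fun m hnm => le_antisymm (f.monotone hnm) (hn m hnm)⟩

theorem isNoetherianRing_idealiser_op (hG : IsPolycyclicByFinite G) {p : PrimeSpectrum C}
    (hp : p.asIdeal.IsMaximal) :
    IsNoetherianRing (idealiser (skewExtension G p.asIdeal))ᵐᵒᵖ := by
  let R := idealiser (skewExtension G p.asIdeal)
  have hB : IsNoetherian Bᵐᵒᵖ B := isNoetherian_op hG
  rw [isNoetherianRing_iff, ← monotone_stabilizes_iff_noetherian]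
  intro K
  have hmem : ∀ i (k : R) (r : B) (hr : r ∈ R), MulOpposite.op k ∈ K i →
      MulOpposite.op (k * ⟨r, hr⟩) ∈ K i := fun i k r hr hk =>
    (K i).smul_mem (MulOpposite.op ⟨r, hr⟩) hk
  let KB : ℕ →o RightIdeal B :=
    { toFun := fun i => Submodule.span Bᵐᵒᵖ {x | ∃ k : R, MulOpposite.op k ∈ K i ∧ x = k}
      monotone' := fun i j hij => Submodule.span_mono
        fun x ⟨k, hk, hx⟩ => ⟨k, K.monotone hij hk, hx⟩ }
  let KJ : ℕ →o RightIdeal B :=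
    { toFun := fun i => Submodule.span Bᵐᵒᵖ
        {x | ∃ k : R, MulOpposite.op k ∈ K i ∧ ∃ c ∈ p.asIdeal, x = (k : B) * single 1 c}
      monotone' := fun i j hij => Submodule.span_mono
        fun x ⟨k, hk, hx⟩ => ⟨k, K.monotone hij hk, hx⟩ }
  obtain ⟨n₁, h₁⟩ := monotone_stabilizes_iff_noetherian.2 hB KB
  obtain ⟨n₂, h₂⟩ := monotone_stabilizes_iff_noetherian.2 hB KJ
  let S : ℕ → AddSubgroup B := fun i =>
    ((K i).toAddSubgroup.comap MulOpposite.opAddEquiv.toAddMonoidHom).map R.subtype.toAddMonoidHom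
  have mem_S : ∀ i (x : B), x ∈ S i ↔ ∃ k : R, MulOpposite.op k ∈ K i ∧ (k : B) = x :=
    fun i x => Iff.rfl
  have S_mul : ∀ i, ∀ x ∈ S i, ∀ r ∈ R, x * r ∈ S i := by
    rintro i _ ⟨k, hk, rfl⟩ r hr
    exact ⟨_, hmem i k r hr hk, rfl⟩
  -- `KIB ⊆ K`, because `IB ⊆ R`.
  have hKJ : ∀ i, ∀ x ∈ KJ i, x ∈ S i := by
    intro i x hx
    suffices ∀ b : B, x * b ∈ S i by simpa using this 1
    induction hx using Submodule.span_induction with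
    | mem x hx =>
      obtain ⟨k, hk, c, hc, rfl⟩ := hx
      intro b
      rw [mul_assoc]
      exact S_mul i _ ⟨k, hk, rfl⟩ _ (mul_mem_idealiser hp hc b)
    | zero => simp
    | add x y _ _ hx hy => intro b; rw [add_mul]; exact add_mem (hx b) (hy b)
    | smul r x _ hx =>
      intro b
      rw [MulOpposite.smul_eq_mul_unop, mul_assoc]
      exact hx _
  -- A term `a g` with `g • p ≠ p` enters `R` when multiplied on the right by `c` with `g • c ∈ p`;
  -- terms with `g • p = p` already lie in `R`.
  have hKB : ∀ i, ∀ x ∈ KB i, ∃ T : Finset G, (∀ g ∈ T, g • p ≠ p) ∧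
      ∀ c : C, (∀ g ∈ T, g • c ∈ p.asIdeal) → x * single 1 c ∈ S i := by
    classical
    intro i
    have hadd : ∀ x y : B, (∃ T : Finset G, (∀ g ∈ T, g • p ≠ p) ∧
        ∀ c : C, (∀ g ∈ T, g • c ∈ p.asIdeal) → x * single 1 c ∈ S i) →
        (∃ T : Finset G, (∀ g ∈ T, g • p ≠ p) ∧
        ∀ c : C, (∀ g ∈ T, g • c ∈ p.asIdeal) → y * single 1 c ∈ S i) →
        (∃ T : Finset G, (∀ g ∈ T, g • p ≠ p) ∧
        ∀ c : C, (∀ g ∈ T, g • c ∈ p.asIdeal) → (x + y) * single 1 c ∈ S i) := by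
      rintro x y ⟨T, hT, hx⟩ ⟨T', hT', hy⟩
      refine ⟨T ∪ T', fun g hg => (Finset.mem_union.1 hg).elim (hT g) (hT' g), fun c hc => ?_⟩
      rw [add_mul]
      exact add_mem (hx c fun g hg => hc g (Finset.mem_union_left _ hg))
        (hy c fun g hg => hc g (Finset.mem_union_right _ hg))
    intro x hx
    suffices ∀ b : B, ∃ T : Finset G, (∀ g ∈ T, g • p ≠ p) ∧
        ∀ c : C, (∀ g ∈ T, g • c ∈ p.asIdeal) → x * b * single 1 c ∈ S i by
      simpa using this 1
    induction hx using Submodule.span_induction with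
    | mem x hx =>
      obtain ⟨k, hk, rfl⟩ := hx
      intro b
      induction b using induction_on with
      | zero => exact ⟨∅, by simp, by simp⟩
      | single g a =>
        by_cases hg : g • p = p
        · refine ⟨∅, by simp, fun c _ => ?_⟩
          rw [mul_assoc, single_mul_single]
          exact S_mul i _ ⟨k, hk, rfl⟩ _ (single_mem_idealiser hp (.inr (by simpa using hg)))
        · refine ⟨{g}, by simpa using hg, fun c hc => ?_⟩
          rw [mul_assoc, single_mul_single]
          exact S_mul i _ ⟨k, hk, rfl⟩ _ (single_mem_idealiser hp
            (.inl (p.asIdeal.mul_mem_left _ (hc g (by simp)))))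
      | add b b' hb hb' => rw [mul_add]; exact hadd _ _ hb hb'
    | zero => exact fun b => ⟨∅, by simp, by simp⟩
    | add x y _ _ hx hy => intro b; rw [add_mul]; exact hadd _ _ (hx b) (hy b)
    | smul r x _ hx =>
      intro b
      rw [MulOpposite.smul_eq_mul_unop, mul_assoc x]
      exact hx _
  refine ⟨n₁ + n₂, fun m hm => le_antisymm (K.monotone hm) fun x hx => ?_⟩
  obtain ⟨k, rfl⟩ := MulOpposite.op_surjective x
  have hk₁ : (k : B) ∈ KB (n₁ + n₂) := by
    rw [← h₁ _ (Nat.le_add_right _ _), h₁ m (by omega)]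
    exact Submodule.subset_span ⟨k, hx, rfl⟩
  obtain ⟨T, hT, hTc⟩ := hKB _ _ hk₁
  -- Split `k = k c + k (1 - c)`: the first term is handled through `KB`, the second through `KJ`.
  obtain ⟨c, hc1, hcT⟩ := exists_one_sub_mem hp T hT
  have hk₂ : (k : B) * single 1 (1 - c) ∈ KJ (n₁ + n₂) := by
    rw [← h₂ _ (Nat.le_add_left _ _), h₂ m (by omega)]
    exact Submodule.subset_span ⟨k, hx, _, hc1, rfl⟩
  have h3 := add_mem (hTc c hcT) (hKJ _ _ hk₂)
  rw [← mul_add, ← single_add, add_sub_cancel, single_one_one, mul_one] at h3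
  obtain ⟨k', hk', e⟩ := (mem_S _ _).1 h3
  rwa [← Subtype.ext e]

end RightNoetherian

end SkewMonoidAlgebra

/-! ### Left noetherianity from finiteness of zeros on the orbit -/

namespace SkewMonoidAlgebra

section LeftNoetherian

variable {C G : Type*} [CommRing C] [Group G] [MulSemiringAction G C]

local notation "B" => SkewMonoidAlgebra C G

variable (p : PrimeSpectrum C)

/-- A copy of the skew group ring for the generic point and one for each point of the orbit
of `p`. -/
abbrev OrbitSum {C : Type*} (G : Type*) [CommRing C] [Group G] [MulSemiringAction G C]
    (p : PrimeSpectrum C) : Type _ :=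
  SkewMonoidAlgebra C G × (MulAction.orbit G p → SkewMonoidAlgebra C G)

namespace OrbitSum

/-- The action of `G` on `OrbitSum G p`, which also permutes the copies. -/
noncomputable def groupHom : G →* Module.End ℤ (OrbitSum G p) where
  toFun g := AddMonoidHom.toIntLinearMap
    { toFun := fun x => (single g 1 * x.1, fun q => single g 1 * x.2 (g⁻¹ • q))
      map_zero' := by ext <;> simp
      map_add' := fun x y => by simp [mul_add]; rfl }
  map_one' := by ext x <;> simp
  map_mul' g h := by ext x <;> simp [← mul_assoc, single_mul_single, mul_smul]

/-- Multiplication by scalars on the left. -/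
noncomputable def scalar (c : C) : Module.End ℤ (OrbitSum G p) :=
  AddMonoidHom.toIntLinearMap
    { toFun := fun x => (single 1 c * x.1, fun q => single 1 c * x.2 q)
      map_zero' := by ext <;> simp
      map_add' := fun x y => by simp [mul_add]; rfl }

/-- The projection to the copy of the generic point. -/
noncomputable def projGeneric : Module.End ℤ (OrbitSum G p) :=
  AddMonoidHom.toIntLinearMap
    { toFun := fun x => (x.1, 0)
      map_zero' := rfl
      map_add' := fun x y => by simp }

open scoped Classical in
/-- The projection to the copy of the point `q`. -/
noncomputable def proj (q : MulAction.orbit G p) : Module.End ℤ (OrbitSum G p) :=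
  AddMonoidHom.toIntLinearMap
    { toFun := fun x => (0, Pi.single q (x.2 q))
      map_zero' := by simp
      map_add' := fun x y => by simp [Pi.single_add] }

/-- The map from the copy of the point `q` to that of the generic point. -/
noncomputable def toGeneric (q : MulAction.orbit G p) : Module.End ℤ (OrbitSum G p) :=
  AddMonoidHom.toIntLinearMap
    { toFun := fun x => (x.2 q, 0)
      map_zero' := by simp
      map_add' := fun x y => by simp }

open scoped Classical in
/-- Multiplication by a scalar from the copy of the generic point to that of the point `q`. -/
noncomputable def ofGeneric (q : MulAction.orbit G p) (c : C) : Module.End ℤ (OrbitSum G p) :=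
  AddMonoidHom.toIntLinearMap
    { toFun := fun x => (0, Pi.single q (single 1 c * x.1))
      map_zero' := by simp
      map_add' := fun x y => by simp [mul_add, Pi.single_add] }

theorem groupHom_apply (g : G) (x : OrbitSum G p) :
    groupHom p g x = (single g 1 * x.1, fun q => single g 1 * x.2 (g⁻¹ • q)) := rfl

theorem scalar_apply (c : C) (x : OrbitSum G p) :
    scalar p c x = (single 1 c * x.1, fun q => single 1 c * x.2 q) := rfl

theorem projGeneric_apply (x : OrbitSum G p) : projGeneric p x = (x.1, 0) := rfl

open scoped Classical in
theorem proj_apply (q : MulAction.orbit G p) (x : OrbitSum G p) :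
    proj p q x = (0, Pi.single q (x.2 q)) := rfl

theorem toGeneric_apply (q : MulAction.orbit G p) (x : OrbitSum G p) :
    toGeneric p q x = (x.2 q, 0) := rfl

open scoped Classical in
theorem ofGeneric_apply (q : MulAction.orbit G p) (c : C) (x : OrbitSum G p) :
    ofGeneric p q c x = (0, Pi.single q (single 1 c * x.1)) := rfl

open scoped Classical in
theorem groupHom_single (g : G) (q : MulAction.orbit G p) (b : B) :
    groupHom p g (0, Pi.single q b) = (0, Pi.single (g • q) (single g 1 * b)) := by
  rw [groupHom_apply]
  refine Prod.ext (by simp) (funext fun r => ?_)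
  by_cases h : r = g • q
  · subst h; simp
  · have h' : g⁻¹ • r ≠ q := fun e => h (by rw [← e, smul_inv_smul])
    simp [h, h']

/-- The operators on `OrbitSum G p`. -/
def operators : Set (Module.End ℤ (OrbitSum G p)) :=
  {a | (∃ c, a = scalar p c) ∨ a = projGeneric p ∨ (∃ q, a = proj p q) ∨
    (∃ q, a = toGeneric p q) ∨ ∃ q, ∃ c ∈ q.1.asIdeal, a = ofGeneric p q c}

/-- Conjugation by `g` moves an operator at `q` to one at `g • q`. This closure, needed for Hall's
theorem, is why every orbit point has its own copy. -/
theorem conj_mem_operators (g : G) (a : Module.End ℤ (OrbitSum G p)) (ha : a ∈ operators p) :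
    groupHom p g * a * groupHom p g⁻¹ ∈ operators p := by
  classical
  have hg : ∀ b : B, single g 1 * (single g⁻¹ 1 * b) = b := fun b => by
    rw [← mul_assoc, single_mul_single]; simp
  rcases ha with ⟨c, rfl⟩ | rfl | ⟨q, rfl⟩ | ⟨q, rfl⟩ | ⟨q, c, hc, rfl⟩
  · refine .inl ⟨g • c, LinearMap.ext fun x => ?_⟩
    simp only [Module.End.mul_apply, groupHom_apply, scalar_apply, ← mul_assoc,
      single_mul_single]
    simp
  · refine .inr (.inl (LinearMap.ext fun x => ?_))
    simp only [Module.End.mul_apply, projGeneric_apply, groupHom_apply, hg]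
    simp; rfl
  · refine .inr (.inr (.inl ⟨g • q, LinearMap.ext fun x => ?_⟩))
    simp only [Module.End.mul_apply, proj_apply, groupHom_single]
    simp [groupHom_apply, hg]
  · refine .inr (.inr (.inr (.inl ⟨g • q, LinearMap.ext fun x => ?_⟩)))
    simp only [Module.End.mul_apply, toGeneric_apply]
    simp [groupHom_apply, hg]; rfl
  · refine .inr (.inr (.inr (.inr ⟨g • q, g • c, ?_, LinearMap.ext fun x => ?_⟩)))
    · change g⁻¹ • g • c ∈ q.1.asIdeal
      rwa [inv_smul_smul]
    · simp only [Module.End.mul_apply, ofGeneric_apply, groupHom_single]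
      simp only [groupHom_apply, ← mul_assoc, single_mul_single]
      simp

/-- The families of scalars, those at the points `q ≠ p` vanishing at `q`. -/
def scalars : AddSubgroup (OrbitSum G p) where
  carrier := {x | (∃ c, x.1 = single 1 c) ∧ (Function.support x.2).Finite ∧
    ∀ q, ∃ c, x.2 q = single 1 c ∧ (q.1 ≠ p → c ∈ q.1.asIdeal)}
  zero_mem' := ⟨⟨0, by simp⟩, by simp, fun q => ⟨0, by simp⟩⟩
  add_mem' := by
    rintro x y ⟨⟨c, hc⟩, hx, hx'⟩ ⟨⟨d, hd⟩, hy, hy'⟩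
    refine ⟨⟨c + d, by simp [hc, hd]⟩, (hx.union hy).subset (Function.support_add _ _),
      fun q => ?_⟩
    obtain ⟨e, he, he'⟩ := hx' q
    obtain ⟨f, hf, hf'⟩ := hy' q
    exact ⟨e + f, by simp [he, hf], fun h => add_mem (he' h) (hf' h)⟩
  neg_mem' := by
    rintro x ⟨⟨c, hc⟩, hx, hx'⟩
    have hneg : ∀ c : C, -(single 1 c : B) = single 1 (-c) := fun c =>
      (map_neg (singleAddHom (1 : G)) c).symm
    refine ⟨⟨-c, by rw [Prod.fst_neg, hc, hneg]⟩,
      by rwa [Prod.snd_neg, Function.support_neg], fun q => ?_⟩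
    obtain ⟨e, he, he'⟩ := hx' q
    exact ⟨-e, by rw [Prod.snd_neg, Pi.neg_apply, he, hneg], fun h => neg_mem (he' h)⟩

open scoped Classical in
theorem mem_of_components {S : AddSubgroup (OrbitSum G p)} {x : OrbitSum G p}
    (hx : (Function.support x.2).Finite) (h₁ : (x.1, 0) ∈ S)
    (h₂ : ∀ q, (0, Pi.single q (x.2 q)) ∈ S) : x ∈ S := by
  have : x = (x.1, 0) + ∑ q ∈ hx.toFinset, ((0, Pi.single q (x.2 q)) : OrbitSum G p) := by
    refine Prod.ext (by simp [Prod.fst_sum]) (funext fun r => ?_)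
    simp only [Prod.snd_add, Prod.snd_sum, zero_add, Finset.sum_apply, Pi.single_apply]
    simp
  rw [this]
  exact add_mem h₁ (sum_mem fun q _ => h₂ q)

open scoped Classical in
theorem smul_mem_scalars (a : Module.End ℤ (OrbitSum G p)) (ha : a ∈ operators p)
    (x : OrbitSum G p) (hx : x ∈ scalars p) : a • x ∈ scalars p := by
  have hsingle : ∀ (q : MulAction.orbit G p) (c : C), (q.1 ≠ p → c ∈ q.1.asIdeal) →
      ((0, Pi.single q (single 1 c)) : OrbitSum G p) ∈ scalars p := by
    intro q c hc
    refine ⟨⟨0, by simp⟩, (Set.finite_singleton q).subset Pi.support_single_subset, fun r => ?_⟩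
    by_cases h : r = q
    · subst h; exact ⟨c, by simp, hc⟩
    · exact ⟨0, by simp [h], by simp⟩
  have hgen : ∀ c : C, ((single 1 c, 0) : OrbitSum G p) ∈ scalars p := fun c =>
    ⟨⟨c, rfl⟩, by simp, fun r => ⟨0, by simp⟩⟩
  obtain ⟨⟨d, hd⟩, hfin, hx'⟩ := hx
  rcases ha with ⟨c, rfl⟩ | rfl | ⟨q, rfl⟩ | ⟨q, rfl⟩ | ⟨q, c, hc, rfl⟩
  · refine ⟨⟨c * d, ?_⟩, hfin.subset fun q hq h => hq ?_, fun q => ?_⟩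
    · simp [scalar_apply, hd, single_mul_single]
    · simp [scalar_apply, h]
    · obtain ⟨e, he, he'⟩ := hx' q
      exact ⟨c * e, by simp [scalar_apply, he, single_mul_single],
        fun h => Ideal.mul_mem_left _ _ (he' h)⟩
  · rw [Module.End.smul_def, projGeneric_apply, hd]
    exact hgen d
  · obtain ⟨e, he, he'⟩ := hx' q
    rw [Module.End.smul_def, proj_apply, he]
    exact hsingle q e he'
  · obtain ⟨e, he, he'⟩ := hx' q
    rw [Module.End.smul_def, toGeneric_apply, he]
    exact hgen e
  · rw [Module.End.smul_def, ofGeneric_apply, hd, single_mul_single, one_mul, one_smul]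
    exact hsingle q _ fun _ => Ideal.mul_mem_right _ _ hc

variable {p}

open scoped Classical in
/-- The ideal of the scalars that occur in `S` at the point `q`. -/
noncomputable def idealAt {S : AddSubgroup (OrbitSum G p)}
    (hS : IsStableUnder (groupHom (G := G) p) (operators (G := G) p) ⊥ S) (q : MulAction.orbit G p) : Ideal C where
  carrier := {c | (0, Pi.single q (single 1 c)) ∈ S}
  zero_mem' := by
    rw [Set.mem_ofPred, single_zero, Pi.single_zero]
    exact zero_mem S
  add_mem' {a b} ha hb := by
    have := S.add_mem ha hb
    rw [Prod.mk_add_mk, zero_add, ← Pi.single_add, ← single_add] at this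
    exact this
  smul_mem' c x hx := by
    have := hS.op _ (.inl ⟨c, rfl⟩) _ hx
    rw [Module.End.smul_def, scalar_apply] at this
    rw [Set.mem_ofPred]
    convert this using 1
    refine Prod.ext (by simp) (funext fun r => ?_)
    by_cases h : r = q
    · subst h; simp [single_mul_single]
    · simp [h]

/-- The ideal of the scalars that occur in `S` at the generic point. -/
noncomputable def idealGeneric {S : AddSubgroup (OrbitSum G p)}
    (hS : IsStableUnder (groupHom (G := G) p) (operators (G := G) p) ⊥ S) : Ideal C where
  carrier := {c | (single 1 c, 0) ∈ S}
  zero_mem' := by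
    rw [Set.mem_ofPred, single_zero]
    exact zero_mem S
  add_mem' {a b} ha hb := by
    have := S.add_mem ha hb
    rw [Prod.mk_add_mk, zero_add, ← single_add] at this
    exact this
  smul_mem' c x hx := by
    have := hS.op _ (.inl ⟨c, rfl⟩) _ hx
    rw [Module.End.smul_def, scalar_apply] at this
    rw [Set.mem_ofPred]
    convert this using 1
    refine Prod.ext (by simp [single_mul_single]) (funext fun r => by simp)

-- A stable subgroup amounts to ideals `M` and `L_q`, with `toGeneric` giving `L_q ⊆ M` and
-- `ofGeneric` giving `I_q M ⊆ L_q`. Once `M` is constant, only the `q` with `M ⊆ I_q`, and `p`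
-- itself, can still change.
open scoped Classical in
theorem stableACC_scalars [IsNoetherianRing C] (hp : p.asIdeal.IsMaximal)
    (hfin : ∀ M : Ideal C, M ≠ ⊥ → {q : MulAction.orbit G p | M ≤ q.1.asIdeal}.Finite) :
    StableACC (groupHom (G := G) p) (operators (G := G) p) ⊥ (scalars (G := G) p) := by
  intro S hm hS hst
  have hmax : ∀ q : MulAction.orbit G p, q.1.asIdeal.IsMaximal := by
    rintro ⟨_, g, rfl⟩
    exact Ideal.comap_isMaximal_of_surjective (MulSemiringAction.toRingHom G C g⁻¹)
      (MulAction.surjective g⁻¹)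
  let M : ℕ →o Ideal C :=
    { toFun := fun i => idealGeneric (hst i)
      monotone' := fun i j hij c hc => hm hij hc }
  let L : MulAction.orbit G p → ℕ →o Ideal C := fun q =>
    { toFun := fun i => idealAt (hst i) q
      monotone' := fun i j hij c hc => hm hij hc }
  have hLM : ∀ q i, L q i ≤ M i := by
    intro q i c hc
    have := (hst i).op _ (.inr (.inr (.inr (.inl ⟨q, rfl⟩)))) _ hc
    rw [Module.End.smul_def, toGeneric_apply] at this
    have h : ((single 1 c, 0) : OrbitSum G p) ∈ S i := by
      simpa only [Pi.single_eq_same] using this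
    exact h
  have hML : ∀ q i, q.1.asIdeal * M i ≤ L q i := by
    intro q i
    refine Ideal.mul_le.2 fun c hc d hd => ?_
    have := (hst i).op _ (.inr (.inr (.inr (.inr ⟨q, c, hc, rfl⟩)))) _ hd
    rw [Module.End.smul_def, ofGeneric_apply, single_mul_single, one_mul, one_smul] at this
    exact this
  have hLq : ∀ q i, q.1 ≠ p → L q i ≤ q.1.asIdeal := by
    intro q i hq c hc
    obtain ⟨d, hd, hd'⟩ := (hS i hc).2.2 q
    replace hd : (Pi.single q (single 1 c) : MulAction.orbit G p → B) q = single 1 d := hd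
    rw [Pi.single_eq_same] at hd
    rw [single_injective 1 hd]
    exact hd' hq
  obtain ⟨n₀, h₀⟩ := monotone_stabilizes_iff_noetherian.2 ‹IsNoetherianRing C› M
  choose f hf using fun q => monotone_stabilizes_iff_noetherian.2 ‹IsNoetherianRing C› (L q)
  have key : ∃ n, n₀ ≤ n ∧ ∀ m, n ≤ m → ∀ q, L q m ≤ L q n := by
    by_cases hM : M n₀ = ⊥
    · refine ⟨n₀, le_rfl, fun m hnm q => ?_⟩
      refine (hLM q m).trans ?_
      rw [← h₀ m hnm, hM]
      exact bot_le
    -- The point `p` is exceptional because `L_p` need not lie in `I_p`.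
    · have hQ := (hfin _ hM).union (Set.finite_singleton ⟨p, MulAction.mem_orbit_self p⟩)
      refine ⟨n₀ + ∑ q ∈ hQ.toFinset, f q, Nat.le_add_right _ _, fun m hnm q => ?_⟩
      by_cases hq : q ∈ hQ.toFinset
      · have hle : f q ≤ n₀ + ∑ q ∈ hQ.toFinset, f q :=
          (Finset.single_le_sum (f := f) (fun _ _ => Nat.zero_le _) hq).trans
            (Nat.le_add_left _ _)
        rw [← hf q m (hle.trans hnm), hf q _ hle]
      · rw [Set.Finite.mem_toFinset, Set.mem_union, not_or] at hq
        have hqp : q.1 ≠ p := fun h => hq.2 (Subtype.ext h)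
        have hn₀ : n₀ ≤ n₀ + ∑ q ∈ hQ.toFinset, f q := Nat.le_add_right _ _
        refine le_trans ?_ (hML q _)
        rw [← h₀ _ hn₀]
        -- Comaximality turns `I_q ∩ M` into `I_q M`, closing the sandwich around `L_q`.
        have hsup : q.1.asIdeal ⊔ M n₀ = ⊤ := by
          refine (hmax q).1.2 _ (lt_of_le_of_ne le_sup_left fun h => hq.1 ?_)
          exact le_sup_right.trans h.ge
        refine le_trans (le_inf (hLq q m hqp) ?_)
          (Ideal.mul_eq_inf_of_isCoprime (Ideal.isCoprime_iff_sup_eq.2 hsup)).ge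
        rw [h₀ m (hn₀.trans hnm)]
        exact hLM q m
  obtain ⟨n, hn₀, hn⟩ := key
  refine ⟨n, fun m hnm x hx => ?_⟩
  obtain ⟨⟨c, hc⟩, hsupp, hx'⟩ := hS m hx
  refine mem_of_components p hsupp ?_ fun q => ?_
  · rw [hc]
    have h1 : c ∈ M m := by
      have := (hst m).op _ (.inr (.inl rfl)) _ hx
      rwa [Module.End.smul_def, projGeneric_apply, hc] at this
    rw [← h₀ m (hn₀.trans hnm), h₀ n hn₀] at h1
    exact h1
  · obtain ⟨e, he, -⟩ := hx' q
    rw [he]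
    have h1 : e ∈ L q m := by
      have := (hst m).op _ (.inr (.inr (.inl ⟨q, rfl⟩))) _ hx
      rwa [Module.End.smul_def, proj_apply, he] at this
    exact hn m hnm q h1

/-- The elements of the skew group ring that lie in a left ideal `K` of the idealiser. -/
noncomputable def valSubgroup (K : Ideal (idealiser (skewExtension G p.asIdeal))) : AddSubgroup B :=
  K.toAddSubgroup.map (idealiser (skewExtension G p.asIdeal)).subtype.toAddMonoidHom

theorem mem_valSubgroup {K : Ideal (idealiser (skewExtension G p.asIdeal))} {b : B} :
    b ∈ valSubgroup K ↔ ∃ k ∈ K, (k : B) = b := Iff.rfl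

theorem mul_mem_valSubgroup {K : Ideal (idealiser (skewExtension G p.asIdeal))} {r b : B}
    (hr : r ∈ idealiser (skewExtension G p.asIdeal)) (hb : b ∈ valSubgroup K) :
    r * b ∈ valSubgroup K := by
  obtain ⟨k, hk, rfl⟩ := hb
  exact ⟨_, K.mul_mem_left ⟨r, hr⟩ hk, rfl⟩

/-- The subgroup of `OrbitSum G p` that corresponds to a left ideal `K` of the idealiser. -/
noncomputable def ofIdeal (K : Ideal (idealiser (skewExtension G p.asIdeal))) :
    AddSubgroup (OrbitSum G p) where
  carrier := {x | x.1 ∈ Submodule.span B {x | ∃ k ∈ K, x = (k : B)} ∧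
    (Function.support x.2).Finite ∧ ∀ (q : MulAction.orbit G p) (g : G), g • p = q.1 →
      single g⁻¹ 1 * x.2 q ∈ valSubgroup K}
  zero_mem' := ⟨zero_mem _, by simp, fun q g _ => by simp⟩
  add_mem' {x y} hx hy := ⟨add_mem hx.1 hy.1,
    (hx.2.1.union hy.2.1).subset (Function.support_add _ _), fun q g hg => by
      rw [Prod.snd_add, Pi.add_apply, mul_add]
      exact add_mem (hx.2.2 q g hg) (hy.2.2 q g hg)⟩
  neg_mem' {x} hx := ⟨neg_mem hx.1, by rw [Prod.snd_neg, Function.support_neg]; exact hx.2.1, fun q g hg => by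
      rw [Prod.snd_neg, Pi.neg_apply, mul_neg]
      exact neg_mem (hx.2.2 q g hg)⟩

/-- `I · BK = (IB)K ⊆ RK ⊆ K`. This makes the operators `ofGeneric` preserve `ofIdeal K`. -/
theorem mul_mem_valSubgroup_of_mem_span (hp : p.asIdeal.IsMaximal)
    {K : Ideal (idealiser (skewExtension G p.asIdeal))} {c : C} (hc : c ∈ p.asIdeal) {b : B}
    (hb : b ∈ Submodule.span B {x | ∃ k ∈ K, x = (k : B)}) :
    single 1 c * b ∈ valSubgroup K := by
  suffices ∀ b' : B, single 1 c * b' * b ∈ valSubgroup K by simpa using this 1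
  induction hb using Submodule.span_induction with
  | mem x hx =>
    obtain ⟨k, hk, rfl⟩ := hx
    exact fun b' => mul_mem_valSubgroup (mul_mem_idealiser hp hc b') ⟨k, hk, rfl⟩
  | zero => simp
  | add x y _ _ hx hy => intro b'; rw [mul_add]; exact add_mem (hx b') (hy b')
  | smul r x _ hx =>
    intro b'
    rw [smul_eq_mul, ← mul_assoc, mul_assoc (single 1 c)]
    exact hx _

open scoped Classical in
theorem ofIdeal_le (hp : p.asIdeal.IsMaximal)
    (K : Ideal (idealiser (skewExtension G p.asIdeal))) :
    ofIdeal K ≤ translateSpan (groupHom (G := G) p) ⊤ (scalars p) := by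
  intro x hx
  refine mem_of_components p hx.2.1 ?_ fun q => ?_
  · have : x.1 ∈ (translateSpan (groupHom (G := G) p) ⊤ (scalars p)).comap
        (AddMonoidHom.inl B (MulAction.orbit G p → B)) := by
      refine mem_of_single_mem fun g => ?_
      refine AddSubgroup.subset_closure ⟨g, trivial, (single 1 (g⁻¹ • x.1.coeff g), 0),
        ⟨⟨_, rfl⟩, by simp, fun q => ⟨0, by simp⟩⟩, ?_⟩
      rw [Module.End.smul_def, groupHom_apply]
      refine Prod.ext (by simp [single_mul_single]) (by ext; simp)
    exact this
  · obtain ⟨g, hg⟩ := q.2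
    obtain ⟨k, hk, hkx⟩ := hx.2.2 q g hg
    have hkx : (k : B) = single g⁻¹ 1 * x.2 q := hkx
    have hmem : (k : B) ∈ (translateSpan (groupHom (G := G) p) ⊤ (scalars p)).comap
        ((AddMonoidHom.inr B (MulAction.orbit G p → B)).comp (AddMonoidHom.single _
          (⟨p, MulAction.mem_orbit_self p⟩ : MulAction.orbit G p))) := by
      refine mem_of_single_mem fun h => ?_
      have hk := (mem_idealiser_skewExtension hp).1 k.2 h
      -- A term `c h` of `R` in the copy at `p` is the `h`-translate of the scalar `h⁻¹ • c` at `h⁻¹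
      -- • p`. If `h • p ≠ p` then `c ∈ p`, so that scalar vanishes at its point, as `scalars`
      -- demands.
      refine AddSubgroup.subset_closure ⟨h, trivial,
        (0, Pi.single (h⁻¹ • ⟨p, MulAction.mem_orbit_self p⟩) (single 1 (h⁻¹ • (k : B).coeff h))),
        ⟨⟨0, by simp⟩, (Set.finite_singleton _).subset Pi.support_single_subset, fun r => ?_⟩, ?_⟩
      · by_cases hr : r = h⁻¹ • ⟨p, MulAction.mem_orbit_self p⟩
        · subst hr
          refine ⟨_, Pi.single_eq_same _ _, fun hne => ?_⟩
          change h⁻¹⁻¹ • h⁻¹ • _ ∈ p.asIdeal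
          rw [inv_inv, smul_inv_smul]
          exact hk.resolve_right fun e => hne (inv_smul_eq_iff.2 e.symm)
        · exact ⟨0, by simp [hr], by simp⟩
      · rw [Module.End.smul_def, groupHom_single]
        simp [single_mul_single]
    have h2 := (IsStableUnder.translateSpan (conj_mem_operators p) (smul_mem_scalars p)).grp g
      (Subgroup.mem_top g) _ hmem
    rw [Module.End.smul_def] at h2
    change groupHom p g (0, Pi.single _ (k : B)) ∈ _ at h2
    rw [groupHom_single, hkx, ← mul_assoc, single_mul_single] at h2
    convert h2 using 3
    · exact Subtype.ext hg.symm
    · simp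

open scoped Classical in
theorem isStableUnder_ofIdeal (hp : p.asIdeal.IsMaximal)
    (K : Ideal (idealiser (skewExtension G p.asIdeal))) :
    IsStableUnder (groupHom (G := G) p) (operators (G := G) p) ⊤ (ofIdeal K) := by
  have hsingle : ∀ (q : MulAction.orbit G p) (b : B),
      (∀ g : G, g • p = q.1 → single g⁻¹ 1 * b ∈ valSubgroup K) →
      ((0, Pi.single q b) : OrbitSum G p) ∈ ofIdeal K := by
    intro q b hb
    refine ⟨zero_mem _, (Set.finite_singleton _).subset Pi.support_single_subset, fun r g hg => ?_⟩
    by_cases h : r = q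
    · subst h
      simpa only [Pi.single_eq_same] using hb g hg
    · simp [h]
  have hgen : ∀ b : B, b ∈ Submodule.span B {x | ∃ k ∈ K, x = (k : B)} →
      ((b, 0) : OrbitSum G p) ∈ ofIdeal K := fun b hb =>
    ⟨hb, by simp, fun q g hg => by simp⟩
  have hcomm : ∀ (g : G) (c : C) (b : B),
      single g⁻¹ 1 * (single 1 c * b) = single 1 (g⁻¹ • c) * (single g⁻¹ 1 * b) := fun g c b => by
    simp [← mul_assoc, single_mul_single]
  constructor
  · rintro a ha x ⟨hx₁, hx₂, hx₃⟩
    rcases ha with ⟨c, rfl⟩ | rfl | ⟨q, rfl⟩ | ⟨q, rfl⟩ | ⟨q, c, hc, rfl⟩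
    · refine ⟨Submodule.smul_mem _ _ hx₁, hx₂.subset fun q hq h => hq ?_, fun q g hg => ?_⟩
      · simp [scalar_apply, h]
      · change single g⁻¹ 1 * (single 1 c * x.2 q) ∈ _
        rw [hcomm]
        exact mul_mem_valSubgroup (single_mem_idealiser hp (.inr (one_smul _ _))) (hx₃ q g hg)
    · exact hgen _ hx₁
    · exact hsingle q _ (hx₃ q)
    · refine hgen _ ?_
      obtain ⟨g, hg⟩ := q.2
      obtain ⟨k, hk, hkx⟩ := hx₃ q g hg
      have hkx : (k : B) = single g⁻¹ 1 * x.2 q := hkx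
      have : x.2 q = (single g 1 : B) • (k : B) := by
        rw [hkx, smul_eq_mul, ← mul_assoc, single_mul_single]
        simp
      rw [this]
      exact Submodule.smul_mem _ _ (Submodule.subset_span ⟨k, hk, rfl⟩)
    · refine hsingle q _ fun g hg => ?_
      rw [hcomm]
      refine mul_mem_valSubgroup_of_mem_span hp ?_ (Submodule.smul_mem _ _ hx₁)
      rwa [← hg] at hc
  · rintro h - x ⟨hx₁, hx₂, hx₃⟩
    refine ⟨Submodule.smul_mem _ _ hx₁, ?_, fun q g hg => ?_⟩
    · refine (hx₂.image (h • ·)).subset fun q hq => ⟨h⁻¹ • q, fun e => hq ?_, by simp⟩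
      simp [groupHom_apply, e]
    · change single g⁻¹ 1 * (single h 1 * x.2 (h⁻¹ • q)) ∈ _
      have := hx₃ (h⁻¹ • q) (h⁻¹ * g) (by rw [mul_smul, hg]; rfl)
      simpa [← mul_assoc, single_mul_single] using this

/-- The copy at `p` recovers `K`: elements of the stabiliser of `p` lie in `R`, so the conditions
for all `g` with `g • p = p` reduce to that for `g = 1`. -/
theorem le_of_ofIdeal_le (hp : p.asIdeal.IsMaximal)
    {K K' : Ideal (idealiser (skewExtension G p.asIdeal))}
    (h : ofIdeal K ≤ ofIdeal K') : K ≤ K' := by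
  classical
  intro k hk
  have h1 : ((0, Pi.single ⟨p, MulAction.mem_orbit_self p⟩ (k : B)) : OrbitSum G p) ∈
      ofIdeal K := by
    refine ⟨zero_mem _, (Set.finite_singleton _).subset Pi.support_single_subset, fun r g hg => ?_⟩
    by_cases hr : r = ⟨p, MulAction.mem_orbit_self p⟩
    · subst hr
      have := mul_mem_valSubgroup (single_mem_idealiser hp (g := g⁻¹) (c := 1)
        (.inr (inv_smul_eq_iff.2 hg.symm))) (mem_valSubgroup.2 ⟨k, hk, rfl⟩)
      simpa using this
    · simp [hr]
  obtain ⟨k', hk', e⟩ := (h h1).2.2 ⟨p, MulAction.mem_orbit_self p⟩ 1 (one_smul _ _)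
  have e : (k' : B) = k := by simpa using e
  rwa [← Subtype.ext e]

theorem ofIdeal_mono {K K' : Ideal (idealiser (skewExtension G p.asIdeal))} (h : K ≤ K') :
    ofIdeal K ≤ ofIdeal K' := by
  intro x hx
  refine ⟨Submodule.span_mono ?_ hx.1, hx.2.1, fun q g hg => ?_⟩
  · rintro y ⟨k, hk, e⟩
    exact ⟨k, h hk, e⟩
  obtain ⟨k, hk, e⟩ := hx.2.2 q g hg
  exact ⟨k, h hk, e⟩

end OrbitSum

theorem isNoetherianRing_idealiser [IsNoetherianRing C] (hG : IsPolycyclicByFinite G)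
    {p : PrimeSpectrum C} (hp : p.asIdeal.IsMaximal)
    (hfin : ∀ M : Ideal C, M ≠ ⊥ → {q : MulAction.orbit G p | M ≤ q.1.asIdeal}.Finite) :
    IsNoetherianRing (idealiser (skewExtension G p.asIdeal)) := by
  rw [isNoetherianRing_iff, ← monotone_stabilizes_iff_noetherian]
  intro K
  obtain ⟨n, hn⟩ := StableACC.of_isPolycyclicByFinite hG (OrbitSum.conj_mem_operators p)
    (OrbitSum.smul_mem_scalars p) (OrbitSum.stableACC_scalars hp hfin)
    (fun i => OrbitSum.ofIdeal (K i)) (fun i j hij => OrbitSum.ofIdeal_mono (K.monotone hij))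
    (fun i => OrbitSum.ofIdeal_le hp _) (fun i => OrbitSum.isStableUnder_ofIdeal hp _)
  exact ⟨n, fun m hnm => le_antisymm (K.monotone hnm) (OrbitSum.le_of_ofIdeal_le hp (hn m hnm))⟩

end LeftNoetherian

end SkewMonoidAlgebra

/-! ### The converse: zeros on the orbit of a nonzero scalar -/

namespace SkewMonoidAlgebra

section Converse

variable {C G : Type*} [CommRing C] [Group G] [MulSemiringAction G C]

local notation "B" => SkewMonoidAlgebra C G

/-- The elements of the skew group ring whose coefficient at `g` lies in `I (g • f)`. -/
def coeffSubgroup (I : Ideal C) (f : C) (g : G) : AddSubgroup B where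
  carrier := {x | ∃ c ∈ I, x.coeff g = c * g • f}
  zero_mem' := ⟨0, zero_mem _, by simp⟩
  add_mem' := by
    rintro x y ⟨c, hc, hx⟩ ⟨d, hd, hy⟩
    exact ⟨c + d, add_mem hc hd, by simp [hx, hy, add_mul]⟩
  neg_mem' := by
    rintro x ⟨c, hc, hx⟩
    exact ⟨-c, neg_mem hc, by simp [hx]⟩

/-- A term of `r` at `h` with `h • p = p` contributes nothing at `g`, since `h⁻¹ * g` sends `g⁻¹ •
p` to `p` and so is outside the support. All other terms have coefficients in `p`. -/
theorem mul_mem_coeffSubgroup {p : PrimeSpectrum C} (hp : p.asIdeal.IsMaximal) {f : C} {g : G}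
    {r b : B} (hr : r ∈ idealiser (skewExtension G p.asIdeal))
    (hg : ∀ k ∈ (b * single 1 f).support, k⁻¹ • p ≠ g⁻¹ • p) :
    r * (b * single 1 f) ∈ coeffSubgroup p.asIdeal f g := by
  suffices r ∈ (coeffSubgroup p.asIdeal f g).comap (AddMonoidHom.mulRight (b * single 1 f)) from
    this
  refine mem_of_single_mem fun h => ?_
  change single h _ * (b * single 1 f) ∈ coeffSubgroup p.asIdeal f g
  rcases (mem_idealiser_skewExtension hp).1 hr h with hI | hp'
  · refine ⟨r.coeff h * h • b.coeff (h⁻¹ * g), Ideal.mul_mem_right _ _ hI, ?_⟩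
    rw [← mul_assoc, coeff_mul_single_one, coeff_single_mul]
  · refine ⟨0, zero_mem _, ?_⟩
    rw [coeff_single_mul, zero_mul]
    have : (b * single 1 f).coeff (h⁻¹ * g) = 0 := by
      by_contra hne
      refine hg _ (mem_support_iff.2 hne) ?_
      rw [mul_inv_rev, inv_inv, mul_smul, hp']
    rw [this, smul_zero, mul_zero]

/-- If the idealiser is left noetherian then a nonzero element of `C` vanishes at only finitely
many points of the orbit. -/
theorem finite_of_isNoetherianRing_idealiser [IsDomain C] {p : PrimeSpectrum C}
    (hp : p.asIdeal.IsMaximal) (h : IsNoetherianRing (idealiser (skewExtension G p.asIdeal)))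
    {f : C} (hf : f ≠ 0) : (MulAction.orbit G p ∩ {q | f ∈ q.asIdeal}).Finite := by
  classical
  let R := idealiser (skewExtension G p.asIdeal)
  -- The left ideal `IB ∩ Bf` of `R`.
  let K : Ideal R :=
    { carrier := {r | (r : B) ∈ skewExtension G p.asIdeal ∧ ∃ b : B, (r : B) = b * single 1 f}
      zero_mem' := ⟨zero_mem _, 0, by simp⟩
      add_mem' := by
        rintro x y ⟨hx, b, hb⟩ ⟨hy, b', hb'⟩
        exact ⟨add_mem hx hy, b + b', by rw [Subring.coe_add, hb, hb', add_mul]⟩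
      smul_mem' := by
        rintro r x ⟨hx, b, hb⟩
        exact ⟨r.2 _ hx, r * b, by rw [smul_eq_mul, Subring.coe_mul, hb, mul_assoc]⟩ }
  obtain ⟨s, hs⟩ := (isNoetherianRing_iff_ideal_fg R).1 h K
  let P : Finset (PrimeSpectrum C) := s.biUnion fun t => (t : B).support.image fun k => k⁻¹ • p
  refine P.finite_toSet.subset ?_
  rintro _ ⟨⟨g, rfl⟩, hq⟩
  by_contra hP
  have hgf : g⁻¹ • f ∈ p.asIdeal := hq
  -- This is `g⁻¹ f`, an element of `K` since `f` vanishes at `g • p`. If `g • p` is missed by the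
  -- generators, its coefficient `g⁻¹ • f` lies in `p` times itself, which forces `1 ∈ p`.
  have hx : single g⁻¹ (g⁻¹ • f) ∈ R := single_mem_idealiser hp (.inl hgf)
  have hxK : (⟨_, hx⟩ : R) ∈ K := by
    refine ⟨mem_skewExtension.2 fun k => ?_, single g⁻¹ 1, by simp [single_mul_single]⟩
    rw [coeff_single_apply]
    split_ifs
    · exact hgf
    · exact zero_mem _
  have key : ∀ x ∈ Ideal.span (s : Set R), ∀ r : R,
      ((r * x : R) : B) ∈ coeffSubgroup p.asIdeal f g⁻¹ := by
    intro x hx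
    induction hx using Submodule.span_induction with
    | mem t ht =>
      intro r
      obtain ⟨-, b, hb⟩ : t ∈ K := hs ▸ Ideal.subset_span ht
      rw [Subring.coe_mul, hb]
      refine mul_mem_coeffSubgroup hp r.2 fun k hk e => hP ?_
      rw [← hb] at hk
      rw [inv_inv] at e
      exact Finset.mem_coe.2 (Finset.mem_biUnion.2 ⟨t, ht, Finset.mem_image.2 ⟨k, hk, e⟩⟩)
    | zero => intro r; rw [mul_zero]; exact zero_mem _
    | add x y _ _ hx hy => intro r; rw [mul_add]; exact add_mem (hx r) (hy r)
    | smul r' x _ hx => intro r; rw [smul_eq_mul, ← mul_assoc]; exact hx _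
  obtain ⟨c, hc, e⟩ := key _ (hs.symm ▸ hxK) 1
  rw [one_mul, coeff_single, Finsupp.single_eq_same] at e
  have h0 : g⁻¹ • f ≠ 0 := by rwa [Ne, smul_eq_zero_iff_eq]
  have h1 : c = 1 := mul_right_cancel₀ h0 (by rw [one_mul]; exact e.symm)
  exact hp.ne_top ((Ideal.eq_top_iff_one _).2 (h1 ▸ hc))

end Converse

end SkewMonoidAlgebra

/-! ### Critical density as finiteness of zeros -/

theorem mainTheorem5 {k C G : Type*} [Field k] [IsAlgClosed k]
    [CommRing C] [IsDomain C] [IsNoetherianRing C] [Algebra k C]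
    [Group G] (hG : IsPolycyclicByFinite G) [MulSemiringAction G C]
    (I : Ideal C) (hI : I.IsMaximal)
    (p : PrimeSpectrum C) (hp : PrimeSpectrum.zeroLocus (I : Set C) = {p}) :
    IsNoetherianRing (idealiser (skewExtension G I))ᵐᵒᵖ ∧
      (IsNoetherianRing (idealiser (skewExtension G I)) ↔
        ((MulAction.orbit G p).Finite ∨ IsCriticallyDense (MulAction.orbit G p))) := by
  have hpI : p ∈ PrimeSpectrum.zeroLocus (I : Set C) := hp ▸ rfl
  obtain rfl : I = p.asIdeal := hI.eq_of_le p.2.ne_top hpI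
  refine ⟨SkewMonoidAlgebra.isNoetherianRing_idealiser_op hG hI, fun h => ?_, fun h => ?_⟩
  · refine or_iff_not_imp_left.2 fun hinf => ⟨hinf, fun Y hY hne => ?_⟩
    obtain ⟨s, rfl⟩ := (PrimeSpectrum.isClosed_iff_zeroLocus Y).1 hY
    obtain ⟨f, hfs, hf⟩ : ∃ f ∈ s, f ≠ 0 := by
      by_contra! hs
      exact hne (Set.eq_univ_of_forall fun q f hf => by simp [hs f hf])
    exact (SkewMonoidAlgebra.finite_of_isNoetherianRing_idealiser hI h hf).subset
      (Set.inter_subset_inter_right _ fun q hq => hq hfs)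
  · refine SkewMonoidAlgebra.isNoetherianRing_idealiser hG hI fun M hM => ?_
    have hfin : (MulAction.orbit G p ∩ PrimeSpectrum.zeroLocus (M : Set C)).Finite := by
      rcases h with h | h
      · exact h.inter_of_left _
      · refine h.2 _ (PrimeSpectrum.isClosed_zeroLocus _) fun hu => hM (le_bot_iff.1 ?_)
        -- In a domain the zero ideal is a point of the spectrum, so a nonzero ideal has a proper
        -- zero locus.
        have : (⊥ : PrimeSpectrum C) ∈ PrimeSpectrum.zeroLocus (M : Set C) := hu ▸ trivial
        exact this
    exact (hfin.preimage Subtype.val_injective.injOn).subset fun q hq => ⟨q.2, hq⟩
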